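/- Let $\rho\in(-1,1)$, $\eta>0$, $\gamma\in(0,1)$, and for $x>0$ let $\varphi(x)=\dfrac{\eta}{x^{\gamma}(1+x)^{1-\gamma}}$. Let $\theta:(0,\infty)\to(0,\infty)$, $T\mapsto\theta_T$, be differentiable with $\partial_T\theta_T\ge 0$ for all $T>0$. The SSVI total implied variance surface with the modified power-law function $\varphi$ (SSVI-MPL) is $$w(k,T)=\frac{\theta_T}{2}\Big(1+\rho\,\varphi(\theta_T)k+\sqrt{(\varphi(\theta_T)k+\rho)^2+1-\rho^2}\Big),\qquad k\in\mathbb R,\ T>0,$$ where $k$ is the log-forward moneyness. The corresponding normalised call prices (undiscounted, divided by the forward) are, for forward moneyness $K>0$ and with $k=\log K$, $C(K,T)=N(d_+)-K\,N(d_-)$, where $d_\pm=-k/\sqrt{w(k,T)}\pm\tfrac12\sqrt{w(k,T)}$ and $N$ is the standard normal distribution function. The surface is called free of static arbitrage if - (no calendar spread arbitrage) for every $K>0$ the map $T\mapsto C(K,T)$ is non-decreasing on $(0,\infty)$, and - (no butterfly arbitrage) for every $T>0$ there is a non-negative probability density $q_T$ on $(0,\infty)$ with mean $1$ such that $C(K,T)=\int_0^\infty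 (s-K)^+q_T(s)\,ds$ for all $K>0$. Then: (i) If $\gamma\in(0,1/2)\cup(1/2,1)$ and $\eta(1+|\rho|)\le 4$, there exists $\theta^*>0$, depending only on $\rho,\eta,\gamma$, such that the SSVI-MPL is free of static arbitrage for every such curve $\theta$ with $\theta_T\ge\theta^*$ for all $T>0$. (ii) If $\gamma\in(0,1/2)$, $\eta(1+|\rho|)\le 4$ and $(1-2\gamma)\,\varphi(1-2\gamma)^2(1+|\rho|)\le 4$, the SSVI-MPL is free of static arbitrage. (iii) If $\gamma=1/2$ and $\eta^2(1+|\rho|)\le 4$, the SSVI-MPL is free of static arbitrage. In particular, this holds for the parsimonious SSVI, where $\theta_T=aT^p$ with $a>0$ and $p\ge 0$. -/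

import Mathlib

open MeasureTheory ProbabilityTheory Set

noncomputable section

namespace SSVI

/-- The standard normal cumulative distribution function. -/
def stdNormalCDF (x : ℝ) : ℝ := cdf (gaussianReal 0 1) x

/-- The Black--Scholes price of a European call, undiscounted and divided by the forward, as a
function of the log-forward moneyness `k = log (strike / forward)` and of the total implied
variance `v = σ² T > 0`:  `N(d₊) - eᵏ N(d₋)` with `d± = -k / √v ± √v / 2`. -/
def bsCall (k v : ℝ) : ℝ :=
  stdNormalCDF (-k / √v + √v / 2) - Real.exp k * stdNormalCDF (-k / √v - √v / 2)

/-- The normalised call price of a total implied variance surface `w`, where `w k T` is the total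
implied variance `σ(k,T)² T` at log-forward moneyness `k` and time-to-maturity `T`. Here `K > 0` is
the forward moneyness (the strike divided by the forward). -/
def callPrice (w : ℝ → ℝ → ℝ) (K T : ℝ) : ℝ := bsCall (Real.log K) (w (Real.log K) T)

/-- No calendar spread arbitrage: at every fixed forward moneyness `K`, the normalised call price is
non-decreasing in the time-to-maturity. -/
def FreeOfCalendarSpreadArbitrage (w : ℝ → ℝ → ℝ) : Prop :=
  ∀ K : ℝ, 0 < K → MonotoneOn (fun T => callPrice w K T) (Ioi 0)

/-- No butterfly arbitrage in the slice of time-to-maturity `T`: the density implied by the call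
prices is a genuine (non-negative) probability density `q` of the ratio of the underlying price at
maturity to its forward, of mean one, and each call price is its expected payoff under `q`. -/
def FreeOfButterflyArbitrage (w : ℝ → ℝ → ℝ) (T : ℝ) : Prop :=
  ∃ q : ℝ → ℝ, Measurable q ∧ (∀ s : ℝ, 0 < s → 0 ≤ q s) ∧
    IntegrableOn q (Ioi 0) ∧ ∫ s in Ioi (0 : ℝ), q s = 1 ∧
    IntegrableOn (fun s => s * q s) (Ioi 0) ∧ ∫ s in Ioi (0 : ℝ), s * q s = 1 ∧
    ∀ K : ℝ, 0 < K → callPrice w K T = ∫ s in Ioi (0 : ℝ), max (s - K) 0 * q s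

/-- A total implied variance surface is free of static arbitrage if it is free of calendar spread
arbitrage and each of its time slices is free of butterfly arbitrage. -/
def FreeOfStaticArbitrage (w : ℝ → ℝ → ℝ) : Prop :=
  FreeOfCalendarSpreadArbitrage w ∧ ∀ T : ℝ, 0 < T → FreeOfButterflyArbitrage w T

/-- The SSVI total implied variance surface with correlation parameter `ρ`, function `φ` and
at-the-money total variance curve `θ`. -/
def ssvi (ρ : ℝ) (φ : ℝ → ℝ) (θ : ℝ → ℝ) (k T : ℝ) : ℝ :=
  θ T / 2 * (1 + ρ * φ (θ T) * k + √((φ (θ T) * k + ρ) ^ 2 + (1 - ρ ^ 2)))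

/-- The modified power-law function `φ(x) = η / (x^γ (1 + x)^(1 - γ))`, for `x > 0`. -/
def modPowerLaw (η γ x : ℝ) : ℝ := η / (x ^ γ * (1 + x) ^ (1 - γ))

/-- Admissible at-the-money total variance curves: `θ` is positive and differentiable on `(0, ∞)`
with `∂_T θ ≥ 0`. -/
structure IsATMCurve (θ : ℝ → ℝ) : Prop where
  pos : ∀ T : ℝ, 0 < T → 0 < θ T
  differentiableAt : ∀ T : ℝ, 0 < T → DifferentiableAt ℝ θ T
  deriv_nonneg : ∀ T : ℝ, 0 < T → 0 ≤ deriv θ T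

end SSVI

end

/-!
Butterfly arbitrage is excluded slice by slice. The second strike derivative of the call price is a
positive multiple of Durrleman's function of the slice (`durrleman`). Where that function is
nonnegative, this second derivative is the required density: its integrals are computed from explicit
primitives (`exists_density_of_convex`), whose boundary values follow from `d± → ∓∞` as `k → ±∞`
(`tendsto_div_sqrt_sub`), and from a Mills ratio bound. These limits hold because the total variance
grows more slowly than `2 |k|`, which is the strict inequality `θ φ(θ) (1 + |ρ|) < 4`.

For an SSVI slice put `z = φ k`, `R = √((z + ρ)² + 1 - ρ²)` and `S = 1 + ρ z + R`. Then
`k w' / (2 w) = (R - 1) / (2 R)` and `w'² / w = θ φ² (S - 2 (1 - ρ²)) / (2 R²)`, so that Durrleman's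
function becomes elementary (`durrleman_ssvi`). Its numerator is affine in each of `(θ φ)²` and
`θ φ²`, and is nonnegative when `θ φ (1 + |ρ|)` and `θ φ² (1 + |ρ|)` are at most `4`
(`ssvi_numerator_nonneg`).

Calendar spread arbitrage is excluded because the Black--Scholes price increases with the total
variance (`bsCall_mono`), and the total variance increases with `θ` when `θ φ(θ)` is nondecreasing
and `φ` is nonincreasing (`ssvi_mono_of_antitone`).

For the modified power law, `x φ(x) = η (x / (1 + x)) ^ (1 - γ)` is increasing and less than `η`, and
`x φ(x)² = η² x ^ (1 - 2 γ) / (1 + x) ^ (2 - 2 γ)` is at most `η² / x`. For `γ < 1 / 2` its maximum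
is at `x = 1 - 2 γ` (`rpow_div_one_add_rpow_le`), and for `γ = 1 / 2` it is at most `η²`.
-/

noncomputable section

namespace SSVI

open Filter Topology

/-! ### The standard normal distribution -/

/-- The standard normal density. -/
def stdNormalPDF (x : ℝ) : ℝ := (√(2 * Real.pi))⁻¹ * Real.exp (-(x ^ 2) / 2)

lemma stdNormalPDF_pos (x : ℝ) : 0 < stdNormalPDF x := by
  unfold stdNormalPDF; positivity

lemma gaussianPDFReal_zero_one : gaussianPDFReal 0 1 = stdNormalPDF := by
  ext x; simp [gaussianPDFReal, stdNormalPDF]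

lemma continuous_stdNormalPDF : Continuous stdNormalPDF := by
  unfold stdNormalPDF; fun_prop

lemma integrable_stdNormalPDF : Integrable stdNormalPDF :=
  gaussianPDFReal_zero_one ▸ integrable_gaussianPDFReal 0 1

lemma stdNormalCDF_eq_integral (x : ℝ) : stdNormalCDF x = ∫ t in Iic x, stdNormalPDF t := by
  rw [stdNormalCDF, cdf_eq_real, Measure.real, gaussianReal_apply_eq_integral _ one_ne_zero,
    gaussianPDFReal_zero_one, ENNReal.toReal_ofReal]
  exact integral_nonneg fun t => (stdNormalPDF_pos t).le

lemma hasDerivAt_stdNormalCDF (x : ℝ) : HasDerivAt stdNormalCDF (stdNormalPDF x) x := by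
  have h : stdNormalCDF = fun y => stdNormalCDF 0 + ∫ t in (0 : ℝ)..y, stdNormalPDF t := by
    ext y
    rw [stdNormalCDF_eq_integral, stdNormalCDF_eq_integral,
      ← intervalIntegral.integral_Iic_sub_Iic integrable_stdNormalPDF.integrableOn
        integrable_stdNormalPDF.integrableOn]
    ring
  rw [h]
  exact ((continuous_stdNormalPDF.integral_hasStrictDerivAt 0 x).hasDerivAt).const_add _

lemma hasDerivAt_stdNormalPDF (x : ℝ) : HasDerivAt stdNormalPDF (-x * stdNormalPDF x) x := by
  have h := (((hasDerivAt_pow 2 x).neg.div_const 2).exp).const_mul (√(2 * Real.pi))⁻¹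
  refine h.congr_deriv ?_
  simp only [stdNormalPDF, Pi.neg_apply]
  push_cast
  ring

lemma tendsto_stdNormalCDF_atTop : Tendsto stdNormalCDF atTop (𝓝 1) := tendsto_cdf_atTop _

lemma tendsto_stdNormalCDF_atBot : Tendsto stdNormalCDF atBot (𝓝 0) := tendsto_cdf_atBot _

lemma stdNormalCDF_nonneg (x : ℝ) : 0 ≤ stdNormalCDF x := cdf_nonneg _ _

lemma tendsto_stdNormalPDF_of_sq {l : Filter ℝ} (h : Tendsto (fun x : ℝ => x ^ 2) l atTop) :
    Tendsto stdNormalPDF l (𝓝 0) := by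
  have h1 : Tendsto (fun x : ℝ => -(x ^ 2) / 2) l atBot :=
    (tendsto_neg_atTop_atBot.comp h).atBot_div_const two_pos
  have h2 := (Real.tendsto_exp_atBot.comp h1).const_mul (√(2 * Real.pi))⁻¹
  rw [mul_zero] at h2
  exact h2

lemma tendsto_stdNormalPDF_atTop : Tendsto stdNormalPDF atTop (𝓝 0) :=
  tendsto_stdNormalPDF_of_sq (tendsto_pow_atTop two_ne_zero)

lemma tendsto_stdNormalPDF_atBot : Tendsto stdNormalPDF atBot (𝓝 0) :=
  tendsto_stdNormalPDF_of_sq <| by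
    simpa [Function.comp_def] using
      (tendsto_pow_atTop (α := ℝ) two_ne_zero).comp tendsto_neg_atBot_atTop

/-- A Mills ratio bound: the difference `n - N` has derivative `(-x - 1) n(x) ≥ 0` on `(-∞, -1]` and
vanishes at `-∞`. -/
lemma stdNormalCDF_le_stdNormalPDF {x : ℝ} (hx : x ≤ -1) : stdNormalCDF x ≤ stdNormalPDF x := by
  have hd : ∀ y, HasDerivAt (fun y => stdNormalPDF y - stdNormalCDF y)
      (-y * stdNormalPDF y - stdNormalPDF y) y :=
    fun y => (hasDerivAt_stdNormalPDF y).sub (hasDerivAt_stdNormalCDF y)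
  have hm : MonotoneOn (fun y => stdNormalPDF y - stdNormalCDF y) (Iic (-1)) := by
    refine monotoneOn_of_deriv_nonneg (convex_Iic _)
      (fun y _ => (hd y).continuousAt.continuousWithinAt)
      (fun y _ => (hd y).differentiableAt.differentiableWithinAt) fun y hy => ?_
    rw [interior_Iic] at hy
    rw [(hd y).deriv]
    nlinarith [stdNormalPDF_pos y, mem_Iio.1 hy]
  have hl : Tendsto (fun y => stdNormalPDF y - stdNormalCDF y) atBot (𝓝 0) := by
    simpa using tendsto_stdNormalPDF_atBot.sub tendsto_stdNormalCDF_atBot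
  have := le_of_tendsto hl (b := stdNormalPDF x - stdNormalCDF x) <| by
    filter_upwards [eventually_le_atBot x] with y hy
    exact hm (hy.trans hx : y ≤ -1) hx hy
  linarith

/-- With `d± = -k / s ± s / 2`, the identity `n(d₊) = eᵏ n(d₋)`. -/
lemma stdNormalPDF_dPlus (k : ℝ) {s : ℝ} (hs : s ≠ 0) :
    stdNormalPDF (-k / s + s / 2) = Real.exp k * stdNormalPDF (-k / s - s / 2) := by
  unfold stdNormalPDF
  rw [mul_left_comm, ← Real.exp_add]
  congr 2
  field_simp
  ring

/-! ### Monotonicity of the Black--Scholes price in the total variance -/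

/-- The derivative of the price in `s = √v` is the vega `n(d₊)`, which is positive. -/
lemma bsCall_mono {k v₁ v₂ : ℝ} (hv : 0 < v₁) (h : v₁ ≤ v₂) : bsCall k v₁ ≤ bsCall k v₂ := by
  have hd : ∀ s : ℝ, 0 < s → HasDerivAt
      (fun s => stdNormalCDF (-k / s + s / 2) - Real.exp k * stdNormalCDF (-k / s - s / 2))
      (stdNormalPDF (-k / s + s / 2)) s := by
    intro s hs
    have h1 : HasDerivAt (fun s : ℝ => -k / s) (k / s ^ 2) s := by
      refine ((hasDerivAt_const s (-k)).div (hasDerivAt_id s) hs.ne').congr_deriv ?_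
      simp
    have h2 : HasDerivAt (fun s : ℝ => s / 2) (1 / 2) s := (hasDerivAt_id s).div_const 2
    have h3 := (hasDerivAt_stdNormalCDF (-k / s + s / 2)).comp s (h1.add h2)
    have h4 := (hasDerivAt_stdNormalCDF (-k / s - s / 2)).comp s (h1.sub h2)
    refine (h3.sub (h4.const_mul (Real.exp k))).congr_deriv ?_
    rw [stdNormalPDF_dPlus k hs.ne']
    ring
  have hm : MonotoneOn
      (fun s => stdNormalCDF (-k / s + s / 2) - Real.exp k * stdNormalCDF (-k / s - s / 2))
      (Ioi 0) := by
    refine monotoneOn_of_deriv_nonneg (convex_Ioi _)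
      (fun s hs => (hd s hs).continuousAt.continuousWithinAt)
      (fun s hs => ?_) fun s hs => ?_ <;> rw [interior_Ioi] at hs
    · exact (hd s hs).differentiableAt.differentiableWithinAt
    · rw [(hd s hs).deriv]
      exact (stdNormalPDF_pos _).le
  exact hm (Real.sqrt_pos.2 hv) (Real.sqrt_pos.2 (hv.trans_le h)) (Real.sqrt_le_sqrt h)

/-! ### Recovering a density from call prices -/

/-- Integrating the second derivative of the call price: if `C` is twice differentiable and convex
on `(0, ∞)` with the boundary behaviour of a call price, then its second derivative is a probability
density of mean one which reproduces `C`. The three integrals are evaluated with the primitives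
`C'`, `s C' - C` and `(s - K) C' - C`. -/
lemma exists_density_of_convex {C C' C'' : ℝ → ℝ}
    (hC : ∀ s, 0 < s → HasDerivAt C (C' s) s) (hC' : ∀ s, 0 < s → HasDerivAt C' (C'' s) s)
    (hpos : ∀ s, 0 < s → 0 ≤ C'' s)
    (hC0 : Tendsto C (𝓝[>] 0) (𝓝 1)) (hC'0 : Tendsto C' (𝓝[>] 0) (𝓝 (-1)))
    (hCtop : Tendsto C atTop (𝓝 0)) (hC'top : Tendsto C' atTop (𝓝 0))
    (hsC'top : Tendsto (fun s => s * C' s) atTop (𝓝 0)) :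
    ∃ q : ℝ → ℝ, Measurable q ∧ (∀ s : ℝ, 0 < s → 0 ≤ q s) ∧
      IntegrableOn q (Ioi 0) ∧ ∫ s in Ioi (0 : ℝ), q s = 1 ∧
      IntegrableOn (fun s => s * q s) (Ioi 0) ∧ ∫ s in Ioi (0 : ℝ), s * q s = 1 ∧
      ∀ K : ℝ, 0 < K → C K = ∫ s in Ioi (0 : ℝ), max (s - K) 0 * q s := by
  -- Taking the derivative function itself as density makes measurability automatic.
  have hq : ∀ s, 0 < s → HasDerivAt C' (deriv C' s) s :=
    fun s hs => (hC' s hs).differentiableAt.hasDerivAt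
  have hq0 : ∀ s, 0 < s → 0 ≤ deriv C' s := fun s hs => (hC' s hs).deriv ▸ hpos s hs
  -- `Function.update` supplies the boundary value at `0` that the primitives need.
  have key : ∀ (F f : ℝ → ℝ) (l m : ℝ), (∀ s, 0 < s → HasDerivAt F (f s) s) →
      (∀ s, 0 < s → 0 ≤ f s) → Tendsto F (𝓝[>] 0) (𝓝 l) → Tendsto F atTop (𝓝 m) →
      IntegrableOn f (Ioi 0) ∧ ∫ s in Ioi (0 : ℝ), f s = m - l := by
    intro F f l m hF hf hl hm
    have hne : ∀ᶠ s in atTop, F s = Function.update F 0 l s := by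
      filter_upwards [eventually_gt_atTop 0] with s hs
      rw [Function.update_of_ne hs.ne']
    have hcont : ContinuousWithinAt (Function.update F 0 l) (Ici 0) 0 := by
      rw [continuousWithinAt_update_same]
      rwa [Ici_sdiff_left]
    have hder : ∀ s ∈ Ioi (0 : ℝ), HasDerivAt (Function.update F 0 l) (f s) s := by
      intro s hs
      refine (hF s hs).congr_of_eventuallyEq ?_
      filter_upwards [eventually_gt_nhds hs] with t ht
      rw [Function.update_of_ne (ne_of_gt ht)]
    have hlim := hm.congr' hne
    refine ⟨integrableOn_Ioi_deriv_of_nonneg hcont hder hf hlim, ?_⟩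
    rw [integral_Ioi_of_hasDerivAt_of_nonneg hcont hder hf hlim, Function.update_self]
  have hid0 : Tendsto (fun s : ℝ => s) (𝓝[>] 0) (𝓝 0) :=
    tendsto_nhdsWithin_of_tendsto_nhds tendsto_id
  obtain ⟨hi1, he1⟩ := key C' (deriv C') (-1) 0 hq hq0 hC'0 hC'top
  obtain ⟨hi2, he2⟩ := key (fun s => s * C' s - C s) (fun s => s * deriv C' s) (-1) 0
    (fun s hs => (((hasDerivAt_id s).mul (hq s hs)).sub (hC s hs)).congr_deriv (by simp))
    (fun s hs => mul_nonneg hs.le (hq0 s hs))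
    (by simpa using (hid0.mul hC'0).sub hC0) (by simpa using hsC'top.sub hCtop)
  refine ⟨deriv C', measurable_deriv _, hq0, hi1, by simpa using he1, hi2, by simpa using he2, ?_⟩
  intro K hK
  have hsplit : ∫ s in Ioi (0 : ℝ), max (s - K) 0 * deriv C' s
      = ∫ s in Ioi K, (s - K) * deriv C' s := by
    rw [← integral_indicator measurableSet_Ioi, ← integral_indicator measurableSet_Ioi]
    congr 1
    ext s
    by_cases hs : K < s
    · rw [indicator_of_mem (show s ∈ Ioi (0 : ℝ) from hK.trans hs),
        indicator_of_mem (show s ∈ Ioi K from hs), max_eq_left (by linarith)]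
    · rw [indicator_of_notMem (show s ∉ Ioi K from hs)]
      by_cases h0 : 0 < s
      · rw [indicator_of_mem (show s ∈ Ioi (0 : ℝ) from h0), max_eq_right (by linarith), zero_mul]
      · rw [indicator_of_notMem (show s ∉ Ioi (0 : ℝ) from h0)]
  rw [hsplit, integral_Ioi_of_hasDerivAt_of_nonneg' (g := fun s => (s - K) * C' s - C s) (l := 0)]
  · simp
  · intro s hs
    exact ((((hasDerivAt_id s).sub_const K).mul (hq s (hK.trans_le hs))).sub
      (hC s (hK.trans_le hs))).congr_deriv (by simp)
  · intro s hs
    exact mul_nonneg (sub_nonneg.2 (le_of_lt hs)) (hq0 s (hK.trans hs))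
  · have := (hsC'top.sub (hC'top.const_mul K)).sub hCtop
    simp only [mul_zero, sub_zero] at this
    exact this.congr fun s => by ring

/-! ### Butterfly arbitrage for a smooth slice -/

/-- Durrleman's function of a slice `w` with first and second derivatives `w₁`, `w₂` at `k`, as a
function of these values. Up to a positive factor it is the second derivative of the call price in
the strike. -/
def durrleman (k w w₁ w₂ : ℝ) : ℝ :=
  (1 - k * w₁ / (2 * w)) ^ 2 - w₁ ^ 2 / 4 * (1 / w + 1 / 4) + w₂ / 2

/-- If the total variance grows at most linearly in `x`, with slope less than `2`, then
`x / √w - √w / 2` tends to infinity with `x`. This gives the limits of `d±` at both ends. -/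
lemma tendsto_div_sqrt_sub {l : Filter ℝ} {w x : ℝ → ℝ} {a b : ℝ} (hw : ∀ k, 0 < w k)
    (hx : Tendsto x l atTop) (hb : b < 2) (hle : ∀ k, w k ≤ a + b * x k) :
    Tendsto (fun k => x k / √(w k) - √(w k) / 2) l atTop := by
  refine tendsto_atTop.2 fun M => ?_
  -- By AM-GM, `M √w ≤ ε w / 2 + M² / (2 ε)`; here `ε` is such that `(1 + ε) b / 2 < 1`.
  set ε : ℝ := (2 - b) / 4 with hε
  have hε0 : 0 < ε := by rw [hε]; linarith
  filter_upwards [hx.eventually_ge_atTop 0,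
    hx.eventually_ge_atTop (((1 + ε) / 2 * a + M ^ 2 / (2 * ε)) / ε)] with k hk0 hk
  have hs : 0 < √(w k) := Real.sqrt_pos.2 (hw k)
  have hsq : √(w k) ^ 2 = w k := Real.sq_sqrt (hw k).le
  have h1 : M * √(w k) ≤ ε * w k / 2 + M ^ 2 / (2 * ε) := by
    have h : ε * w k / 2 + M ^ 2 / (2 * ε) - M * √(w k)
        = (ε * √(w k) - M) ^ 2 / (2 * ε) := by
      rw [← hsq]; field_simp; rw [Real.sqrt_sq (Real.sqrt_nonneg _)]; ring
    have : 0 ≤ (ε * √(w k) - M) ^ 2 / (2 * ε) := by positivity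
    linarith
  rw [div_le_iff₀ hε0] at hk
  have h2 : (1 + ε) / 2 * w k ≤ (1 + ε) / 2 * (a + b * x k) := by
    gcongr
    exact hle k
  have h3 : (1 + ε) / 2 * b ≤ 1 - ε := by rw [hε]; nlinarith [sq_nonneg (b - 2)]
  have h4 := mul_le_mul_of_nonneg_right h3 hk0
  have h5 : (M + √(w k) / 2) * √(w k) ≤ x k := by nlinarith
  rw [← le_div_iff₀ hs] at h5
  linarith

/-- A smooth total variance slice, bounded away from zero, with bounded derivative, of slope less
than `2` at both ends, and with nonnegative Durrleman function, is free of butterfly arbitrage. -/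
lemma freeOfButterflyArbitrage_of_durrleman_nonneg {w : ℝ → ℝ → ℝ} {T : ℝ} {v v₁ v₂ : ℝ → ℝ}
    {a b c D : ℝ} (hwv : ∀ k, w k T = v k) (hv : ∀ k, HasDerivAt v (v₁ k) k)
    (hv₁ : ∀ k, HasDerivAt v₁ (v₂ k) k) (hc : 0 < c) (hcv : ∀ k, c ≤ v k) (hD : ∀ k, |v₁ k| ≤ D)
    (hb : b < 2) (hle : ∀ k, v k ≤ a + b * |k|)
    (hg : ∀ k, 0 ≤ durrleman k (v k) (v₁ k) (v₂ k)) :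
    FreeOfButterflyArbitrage w T := by
  have hpos : ∀ k, 0 < v k := fun k => hc.trans_le (hcv k)
  -- Volatility `s = √v`, its derivatives, and `d±`.
  set s : ℝ → ℝ := fun k => √(v k) with hs
  set s₁ : ℝ → ℝ := fun k => v₁ k / (2 * s k) with hs₁
  set dm : ℝ → ℝ := fun k => -k / s k - s k / 2 with hdm
  set dp : ℝ → ℝ := fun k => -k / s k + s k / 2 with hdp
  have spos : ∀ k, 0 < s k := fun k => Real.sqrt_pos.2 (hpos k)
  have ssq : ∀ k, s k ^ 2 = v k := fun k => Real.sq_sqrt (hpos k).le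
  have hsd : ∀ k, HasDerivAt s (s₁ k) k := fun k => (hv k).sqrt (hpos k).ne'
  have hs₁d : ∀ k, HasDerivAt s₁ (v₂ k / (2 * s k) - v₁ k ^ 2 / (4 * s k ^ 3)) k := by
    intro k
    have hk := (spos k).ne'
    refine ((hv₁ k).div ((hsd k).const_mul 2) (by positivity)).congr_deriv ?_
    simp only [hs₁]
    field_simp
    ring
  have hq : ∀ k, HasDerivAt (fun k => -k / s k) (-1 / s k + k * s₁ k / s k ^ 2) k := by
    intro k
    have hk := (spos k).ne'
    refine ((hasDerivAt_id k).neg.div (hsd k) hk).congr_deriv ?_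
    simp only [Pi.neg_apply, id]
    field_simp
    ring
  have hdmd : ∀ k, HasDerivAt dm (-1 / s k + k * s₁ k / s k ^ 2 - s₁ k / 2) k :=
    fun k => (hq k).sub ((hsd k).div_const 2)
  have hdpd : ∀ k, HasDerivAt dp (-1 / s k + k * s₁ k / s k ^ 2 + s₁ k / 2) k :=
    fun k => (hq k).add ((hsd k).div_const 2)
  have hpm : ∀ k, stdNormalPDF (dp k) = Real.exp k * stdNormalPDF (dm k) :=
    fun k => stdNormalPDF_dPlus k (spos k).ne'
  -- The first strike derivative of the price, in terms of `k`.
  set h : ℝ → ℝ := fun k => stdNormalPDF (dm k) * s₁ k - stdNormalCDF (dm k) with hh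
  have hcd : ∀ k, HasDerivAt (fun k => bsCall k (v k)) (Real.exp k * h k) k := by
    intro k
    have h1 := (hasDerivAt_stdNormalCDF (dp k)).comp k (hdpd k)
    have h2 := (Real.hasDerivAt_exp k).mul ((hasDerivAt_stdNormalCDF (dm k)).comp k (hdmd k))
    refine (h1.sub h2).congr_deriv ?_
    simp only [hh, hpm, Function.comp_apply]
    ring
  have hhd : ∀ k, HasDerivAt h
      (stdNormalPDF (dm k) / s k * durrleman k (v k) (v₁ k) (v₂ k)) k := by
    intro k
    have h1 := (hasDerivAt_stdNormalPDF (dm k)).comp k (hdmd k)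
    have h2 := (hasDerivAt_stdNormalCDF (dm k)).comp k (hdmd k)
    refine ((h1.mul (hs₁d k)).sub h2).congr_deriv ?_
    simp only [Function.comp_apply, durrleman, ← ssq]
    have hk := (spos k).ne'
    have e1 : dm k = -k / s k - s k / 2 := rfl
    have e2 : s₁ k = v₁ k / (2 * s k) := rfl
    generalize stdNormalPDF (dm k) = n
    rw [e1, e2]
    field_simp
    ring
  -- Limits of `d±`.
  have hdm_bot : Tendsto dm atBot atTop := by
    have := tendsto_div_sqrt_sub hpos tendsto_abs_atBot_atTop hb hle
    refine this.congr' ?_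
    filter_upwards [eventually_le_atBot 0] with k hk
    simp only [hdm, hs, abs_of_nonpos hk]
  have hdp_top : Tendsto dp atTop atBot := by
    have := tendsto_div_sqrt_sub hpos tendsto_abs_atTop_atTop hb hle
    refine (tendsto_neg_atTop_atBot.comp this).congr' ?_
    filter_upwards [eventually_ge_atTop 0] with k hk
    simp only [hdp, hs, abs_of_nonneg hk, Function.comp_apply]
    ring
  have hmp : ∀ k, dm k ≤ dp k := fun k => by
    simp only [hdm, hdp]
    linarith [spos k]
  have hdp_bot : Tendsto dp atBot atTop := tendsto_atTop_mono hmp hdm_bot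
  have hdm_top : Tendsto dm atTop atBot := tendsto_atBot_mono hmp hdp_top
  have hs₁b : ∀ k, |s₁ k| ≤ D / (2 * √c) := by
    intro k
    have hc' := Real.sqrt_pos.2 hc
    simp only [hs₁]
    rw [abs_div, abs_of_pos (show 0 < 2 * s k by linarith [spos k])]
    have h0 : 0 ≤ D := (abs_nonneg _).trans (hD k)
    have h1 : √c ≤ s k := Real.sqrt_le_sqrt (hcv k)
    gcongr
    exact hD k
  have mul_s₁ : ∀ {l : Filter ℝ} {f : ℝ → ℝ}, Tendsto f l (𝓝 0) →
      Tendsto (fun k => f k * s₁ k) l (𝓝 0) := by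
    intro l f hf
    refine hf.zero_mul_isBoundedUnder_le ?_
    exact isBoundedUnder_of ⟨D / (2 * √c), fun k => hs₁b k⟩
  -- By the Mills ratio bound, `eᵏ N(d₋) ≤ eᵏ n(d₋) = n(d₊)` for large `k`.
  have expN : Tendsto (fun k => Real.exp k * stdNormalCDF (dm k)) atTop (𝓝 0) := by
    refine squeeze_zero' (Eventually.of_forall fun k =>
      mul_nonneg (Real.exp_pos k).le (stdNormalCDF_nonneg _)) ?_
      (tendsto_stdNormalPDF_atBot.comp hdp_top)
    filter_upwards [hdm_top.eventually_le_atBot (-1)] with k hk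
    rw [Function.comp_apply, hpm]
    exact mul_le_mul_of_nonneg_left (stdNormalCDF_le_stdNormalPDF hk) (Real.exp_pos k).le
  have c_top : Tendsto (fun k => bsCall k (v k)) atTop (𝓝 0) := by
    have := (tendsto_stdNormalCDF_atBot.comp hdp_top).sub expN
    rw [sub_zero] at this
    exact this
  have c_bot : Tendsto (fun k => bsCall k (v k)) atBot (𝓝 1) := by
    have := (tendsto_stdNormalCDF_atTop.comp hdp_bot).sub
      (Real.tendsto_exp_atBot.mul (tendsto_stdNormalCDF_atTop.comp hdm_bot))
    rw [zero_mul, sub_zero] at this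
    exact this
  have h_top : Tendsto h atTop (𝓝 0) := by
    simpa using (mul_s₁ (tendsto_stdNormalPDF_atBot.comp hdm_top)).sub
      (tendsto_stdNormalCDF_atBot.comp hdm_top)
  have h_bot : Tendsto h atBot (𝓝 (-1)) := by
    simpa using (mul_s₁ (tendsto_stdNormalPDF_atTop.comp hdm_bot)).sub
      (tendsto_stdNormalCDF_atTop.comp hdm_bot)
  have eh_top : Tendsto (fun k => Real.exp k * h k) atTop (𝓝 0) := by
    have := (mul_s₁ (tendsto_stdNormalPDF_atBot.comp hdp_top)).sub expN
    rw [sub_zero] at this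
    refine this.congr fun k => ?_
    simp only [Function.comp_apply, hpm, hh]
    ring
  have hcall : ∀ K, callPrice w K T = bsCall (Real.log K) (v (Real.log K)) := fun K => by
    rw [callPrice, hwv]
  unfold FreeOfButterflyArbitrage
  simp only [hcall]
  refine exists_density_of_convex (C' := fun K => h (Real.log K))
    (fun K hK => ?_) (fun K hK => (hhd _).comp K (Real.hasDerivAt_log hK.ne')) (fun K hK => ?_)
    (c_bot.comp Real.tendsto_log_nhdsGT_zero) (h_bot.comp Real.tendsto_log_nhdsGT_zero)
    (c_top.comp Real.tendsto_log_atTop) (h_top.comp Real.tendsto_log_atTop) ?_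
  · refine ((hcd _).comp K (Real.hasDerivAt_log hK.ne')).congr_deriv ?_
    rw [Real.exp_log hK]
    field_simp
  · exact mul_nonneg (mul_nonneg (div_pos (stdNormalPDF_pos _) (spos _)).le (hg _))
      (inv_pos.2 hK).le
  · refine (eh_top.comp Real.tendsto_log_atTop).congr' ?_
    filter_upwards [eventually_gt_atTop 0] with K hK
    rw [Function.comp_apply, Real.exp_log hK]

/-! ### Butterfly arbitrage for an SSVI slice -/

/-- With `S = 1 + ρ z + R` and `R = √((z + ρ)² + 1 - ρ²)`, the identity behind the bounds
`2 (1 - ρ²) ≤ S` and `S (S - 2 (1 - ρ²)) ≤ ((1 + |ρ|) R)²`. -/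
lemma ssvi_sq_identity {ρ z R : ℝ} (hR : R ^ 2 = (z + ρ) ^ 2 + (1 - ρ ^ 2)) :
    (ρ * R + (z + ρ)) ^ 2 = (1 + ρ * z + R) * (1 + ρ * z + R - 2 * (1 - ρ ^ 2)) := by
  linear_combination (ρ ^ 2 - 1) * hR

lemma ssvi_factor_pos {ρ z R : ℝ} (hρ : ρ ^ 2 < 1) (hR0 : 0 < R)
    (hR : R ^ 2 = (z + ρ) ^ 2 + (1 - ρ ^ 2)) : 0 < 1 + ρ * z + R := by
  have h1 : (R + (1 + ρ * z)) * (R - (1 + ρ * z)) = (1 - ρ ^ 2) * z ^ 2 := by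
    linear_combination hR
  by_contra! h
  have h2 : (R + (1 + ρ * z)) * (R - (1 + ρ * z)) ≤ 0 :=
    mul_nonpos_of_nonpos_of_nonneg (by linarith) (by linarith)
  have h3 : 0 ≤ (1 - ρ ^ 2) * z ^ 2 := mul_nonneg (by linarith) (sq_nonneg z)
  have h4 : z = 0 := by
    have : (1 - ρ ^ 2) * z ^ 2 = 0 := le_antisymm (h1 ▸ h2) h3
    rcases mul_eq_zero.1 this with h | h
    · linarith
    · exact pow_eq_zero_iff two_ne_zero |>.1 h
  subst h4
  linarith

lemma two_mul_le_ssvi_factor {ρ z R : ℝ} (hρ : ρ ^ 2 < 1) (hR0 : 0 < R)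
    (hR : R ^ 2 = (z + ρ) ^ 2 + (1 - ρ ^ 2)) : 2 * (1 - ρ ^ 2) ≤ 1 + ρ * z + R := by
  have h := ssvi_sq_identity hR ▸ sq_nonneg (ρ * R + (z + ρ))
  have := nonneg_of_mul_nonneg_right h (ssvi_factor_pos hρ hR0 hR)
  linarith

/-- Durrleman's function of an SSVI slice in terms of `R` and `S = 1 + ρ z + R`, where `z = φ k`.
It rests on the simplifications `k w' / (2 w) = (R - 1) / (2 R)` and
`w'² / w = θ φ² (S - 2 (1 - ρ²)) / (2 R²)`. -/
lemma durrleman_ssvi {ρ θ φ k R : ℝ} (hρ : ρ ^ 2 < 1) (hθ : 0 < θ) (hR0 : 0 < R)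
    (hR : R ^ 2 = (φ * k + ρ) ^ 2 + (1 - ρ ^ 2)) :
    durrleman k (θ / 2 * (1 + ρ * φ * k + R)) (θ * φ / 2 * (ρ + (φ * k + ρ) / R))
      (θ * φ ^ 2 / 2 * ((1 - ρ ^ 2) / R ^ 3)) =
    ((R + 1) ^ 2
      - (θ * φ) ^ 2 / 16 * ((1 + ρ * (φ * k) + R) * (1 + ρ * (φ * k) + R - 2 * (1 - ρ ^ 2)))
      - θ * φ ^ 2 / 2 *
        (1 + ρ * (φ * k) + R - 2 * (1 - ρ ^ 2) - 2 * (1 - ρ ^ 2) / R)) / (4 * R ^ 2) := by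
  have hS := ssvi_factor_pos hρ hR0 hR
  have hsq := ssvi_sq_identity hR
  rw [mul_assoc ρ φ k]
  set z := φ * k with hz
  have hS' := hS.ne'
  have hw1 : θ * φ / 2 * (ρ + (z + ρ) / R) = θ * φ / 2 * ((ρ * R + (z + ρ)) / R) := by
    field_simp
  have e1 : k * (θ * φ / 2 * (ρ + (z + ρ) / R)) / (2 * (θ / 2 * (1 + ρ * z + R)))
      = (R - 1) / (2 * R) := by
    rw [hw1, div_eq_div_iff (by positivity) (by positivity)]
    field_simp
    linear_combination -hR - (ρ * R + (z + ρ)) * hz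
  have e2 : (θ * φ / 2 * (ρ + (z + ρ) / R)) ^ 2
      = (θ * φ) ^ 2 / 4 * ((1 + ρ * z + R) * (1 + ρ * z + R - 2 * (1 - ρ ^ 2))) / R ^ 2 := by
    rw [hw1, ← hsq]
    field_simp
    ring
  rw [durrleman, e1, e2]
  generalize 1 + ρ * z + R = S at *
  field_simp
  ring

/-- Nonnegativity of the numerator in `durrleman_ssvi`, with `A = θ φ`, `B = θ φ²` and `r = |ρ|`.
The worst case is `A = B = 4 / (1 + r)` and `S = (1 + r) (R + 1 - r)`, where `(1 + r)²` times the
numerator reduces to `(1 + r)² r² + 4 (1 + r) (1 - r²) (1 + 1 / R)`. -/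
lemma ssvi_numerator_nonneg {A B r R S : ℝ} (hA0 : 0 ≤ A) (hr0 : 0 ≤ r) (hr1 : r < 1)
    (hR0 : 0 < R) (hS0 : 0 < S) (hA : A * (1 + r) ≤ 4) (hB0 : 0 ≤ B) (hB : B * (1 + r) ≤ 4)
    (hS : S ≤ (1 + r) * (R + 1 - r)) (hP0 : 0 ≤ S * (S - 2 * (1 - r ^ 2)))
    (hP : S * (S - 2 * (1 - r ^ 2)) ≤ ((1 + r) * R) ^ 2) :
    0 ≤ (R + 1) ^ 2 - A ^ 2 / 16 * (S * (S - 2 * (1 - r ^ 2)))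
      - B / 2 * (S - 2 * (1 - r ^ 2) - 2 * (1 - r ^ 2) / R) := by
  have hm : 0 < 1 + r := by linarith
  have hσ : 0 ≤ 1 - r ^ 2 := sub_nonneg.2 (pow_le_one₀ hr0 hr1.le)
  have hRinv : 0 ≤ (1 - r ^ 2) / R := div_nonneg hσ hR0.le
  set P := S * (S - 2 * (1 - r ^ 2)) with hPdef
  set Q := S - 2 * (1 - r ^ 2) - 2 * (1 - r ^ 2) / R with hQdef
  refine nonneg_of_mul_nonneg_right (a := (1 + r) ^ 2) ?_ (by positivity)
  have hA2 : (1 + r) ^ 2 * (A ^ 2 / 16 * P) ≤ P := by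
    have : (A * (1 + r)) ^ 2 ≤ 4 ^ 2 := by gcongr
    linarith [mul_le_mul_of_nonneg_right this hP0]
  rw [mul_sub, mul_sub]
  rcases le_total Q 0 with hQ | hQ
  · have h1 : (1 + r) ^ 2 * (B / 2 * Q) ≤ 0 :=
      mul_nonpos_of_nonneg_of_nonpos (by positivity)
        (mul_nonpos_of_nonneg_of_nonpos (by positivity) hQ)
    have h2 : ((1 + r) * R) ^ 2 ≤ (1 + r) ^ 2 * (R + 1) ^ 2 := by
      rw [mul_pow]
      gcongr
      linarith
    linarith
  · have hB2 : (1 + r) ^ 2 * (B / 2 * Q) ≤ 2 * (1 + r) * Q := by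
      linarith [mul_le_mul_of_nonneg_right hB (mul_nonneg hm.le hQ)]
    have hX1 : S ^ 2 ≤ ((1 + r) * (R + 1 - r)) ^ 2 := pow_le_pow_left₀ hS0.le hS 2
    have hX2 : 2 * (1 + r) * r * S ≤ 2 * (1 + r) * r * ((1 + r) * (R + 1 - r)) :=
      mul_le_mul_of_nonneg_left hS (by positivity)
    have hfin : (1 + r) ^ 2 * (R + 1) ^ 2 - P - 2 * (1 + r) * Q =
        (((1 + r) * (R + 1 - r)) ^ 2 + 2 * (1 + r) * r * ((1 + r) * (R + 1 - r))
          - (S ^ 2 + 2 * (1 + r) * r * S)) + ((1 + r) ^ 2 * r ^ 2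
          + 4 * ((1 + r) * (1 - r ^ 2)) + 4 * ((1 + r) * ((1 - r ^ 2) / R))) := by
      rw [hQdef, hPdef]; ring
    have h1 := mul_nonneg hm.le hσ
    have h2 := mul_nonneg hm.le hRinv
    have h3 : 0 ≤ (1 + r) ^ 2 * r ^ 2 := by positivity
    linarith

lemma durrleman_ssvi_nonneg {ρ θ φ k R : ℝ} (hρ : ρ ^ 2 < 1) (hθ : 0 < θ) (hφ : 0 < φ) (hR0 : 0 < R)
    (hR : R ^ 2 = (φ * k + ρ) ^ 2 + (1 - ρ ^ 2)) (hA : θ * φ * (1 + |ρ|) ≤ 4)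
    (hB : θ * φ ^ 2 * (1 + |ρ|) ≤ 4) :
    0 ≤ durrleman k (θ / 2 * (1 + ρ * φ * k + R)) (θ * φ / 2 * (ρ + (φ * k + ρ) / R))
      (θ * φ ^ 2 / 2 * ((1 - ρ ^ 2) / R ^ 3)) := by
  rw [durrleman_ssvi hρ hθ hR0 hR]
  have hv : |φ * k + ρ| ≤ R := abs_le_of_sq_le_sq (by linarith) hR0.le
  have hsq := ssvi_sq_identity hR
  have hρv : ρ * (φ * k + ρ) ≤ |ρ| * R :=
    (le_abs_self _).trans (by rw [abs_mul]; exact mul_le_mul_of_nonneg_left hv (abs_nonneg ρ))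
  have hP : (ρ * R + (φ * k + ρ)) ^ 2 ≤ ((1 + |ρ|) * R) ^ 2 := by
    refine sq_le_sq.2 ?_
    rw [abs_of_pos (show 0 < (1 + |ρ|) * R by positivity)]
    calc |ρ * R + (φ * k + ρ)| ≤ |ρ * R| + |φ * k + ρ| := abs_add_le _ _
      _ ≤ |ρ| * R + R := by rw [abs_mul, abs_of_pos hR0]; linarith
      _ = (1 + |ρ|) * R := by ring
  have hP0 := sq_nonneg (ρ * R + (φ * k + ρ))
  rw [hsq, ← sq_abs ρ] at hP hP0
  rw [← sq_abs ρ]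
  refine div_nonneg (ssvi_numerator_nonneg (by positivity) (abs_nonneg ρ) ?_ hR0
    (ssvi_factor_pos hρ hR0 hR) hA (by positivity) hB ?_ hP0 hP) (by positivity)
  · rwa [← sq_lt_one_iff₀ (abs_nonneg ρ), sq_abs]
  · linarith [sq_abs ρ]

/-- The Gatheral--Jacquier sufficient condition for the absence of butterfly arbitrage. -/
lemma freeOfButterflyArbitrage_ssvi {ρ : ℝ} {φ θ : ℝ → ℝ} {T : ℝ} (hρ : ρ ^ 2 < 1) (hθ : 0 < θ T)
    (hφ : 0 < φ (θ T)) (hA : θ T * φ (θ T) * (1 + |ρ|) < 4)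
    (hB : θ T * φ (θ T) ^ 2 * (1 + |ρ|) ≤ 4) :
    FreeOfButterflyArbitrage (ssvi ρ φ θ) T := by
  unfold FreeOfButterflyArbitrage
  generalize hf : φ (θ T) = f at *
  generalize ht : θ T = t at *
  set R : ℝ → ℝ := fun k => √((f * k + ρ) ^ 2 + (1 - ρ ^ 2)) with hRdef
  have hin : ∀ k, 0 < (f * k + ρ) ^ 2 + (1 - ρ ^ 2) := fun k => by nlinarith [sq_nonneg (f * k + ρ)]
  have hR0 : ∀ k, 0 < R k := fun k => Real.sqrt_pos.2 (hin k)
  have hR : ∀ k, R k ^ 2 = (f * k + ρ) ^ 2 + (1 - ρ ^ 2) := fun k => Real.sq_sqrt (hin k).le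
  have hlin : ∀ k, HasDerivAt (fun k => f * k + ρ) f k := fun k => by
    simpa using ((hasDerivAt_id k).const_mul f).add_const ρ
  have hRd : ∀ k, HasDerivAt R (f * ((f * k + ρ) / R k)) k := fun k => by
    refine ((((hlin k).pow 2).add_const (1 - ρ ^ 2)).sqrt (hin k).ne').congr_deriv ?_
    have := (hR0 k).ne'
    change _ / (2 * R k) = _
    field_simp
    push_cast
    ring
  have hv : ∀ k, HasDerivAt (fun k => t / 2 * (1 + ρ * f * k + R k))
      (t * f / 2 * (ρ + (f * k + ρ) / R k)) k := fun k => by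
    refine (((((hasDerivAt_id k).const_mul (ρ * f)).const_add 1).add (hRd k)).const_mul
      (t / 2)).congr_deriv ?_
    ring
  have hv₁ : ∀ k, HasDerivAt (fun k => t * f / 2 * (ρ + (f * k + ρ) / R k))
      (t * f ^ 2 / 2 * ((1 - ρ ^ 2) / R k ^ 3)) k := fun k => by
    have h0 := (hR0 k).ne'
    refine ((((hlin k).div (hRd k) h0).const_add ρ).const_mul (t * f / 2)).congr_deriv ?_
    field_simp
    linear_combination hR k
  have habs : ∀ k, |f * k + ρ| ≤ R k := fun k =>
    abs_le_of_sq_le_sq (by rw [hR]; linarith) (hR0 k).le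
  have hρ1 : |ρ| < 1 := by rw [← sq_lt_one_iff₀ (abs_nonneg ρ), sq_abs]; exact hρ
  refine freeOfButterflyArbitrage_of_durrleman_nonneg (w := ssvi ρ φ θ) (T := T)
    (c := t * (1 - ρ ^ 2)) (D := t * f) (a := t) (b := t * f * (1 + |ρ|) / 2)
    (fun k => by rw [ssvi, ht, hf]) hv hv₁ (mul_pos hθ (by linarith)) (fun k => ?_) (fun k => ?_)
    (by linarith) (fun k => ?_)
    fun k => durrleman_ssvi_nonneg hρ hθ hφ (hR0 k) (hR k) hA.le hB
  · have := two_mul_le_ssvi_factor hρ (hR0 k) (hR k)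
    nlinarith
  · have h1 : |(f * k + ρ) / R k| ≤ 1 := by
      rw [abs_div, abs_of_pos (hR0 k)]
      exact (div_le_one (hR0 k)).2 (habs k)
    have h2 := abs_add_le ρ ((f * k + ρ) / R k)
    rw [abs_mul, abs_of_pos (show 0 < t * f / 2 by positivity)]
    have : |ρ + (f * k + ρ) / R k| ≤ 2 := by linarith
    nlinarith [mul_pos hθ hφ]
  · have h1 : ρ * k ≤ |ρ| * |k| := (le_abs_self _).trans (abs_mul ρ k).le
    have h2 : R k ≤ f * |k| + 1 := by
      refine abs_le_of_sq_le_sq' ?_ (by positivity) |>.2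
      rw [hR]
      have : (f * |k| + 1) ^ 2 = (f * k) ^ 2 + 2 * f * |k| + 1 := by
        rw [add_sq, mul_pow, sq_abs]; ring
      have h3 : ρ * k ≤ |k| := h1.trans (mul_le_of_le_one_left (abs_nonneg k) hρ1.le)
      nlinarith
    have h4 : 1 + ρ * f * k + R k ≤ 2 + f * (1 + |ρ|) * |k| := by nlinarith
    calc t / 2 * (1 + ρ * f * k + R k) ≤ t / 2 * (2 + f * (1 + |ρ|) * |k|) := by gcongr
      _ = t + t * f * (1 + |ρ|) / 2 * |k| := by ring

/-! ### Calendar spread arbitrage for SSVI -/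

/-- Writing the total variance as `(θ φ / 2) H(1 / φ, k)` with
`H(x, k) = x + ρ k + √((x + ρ k)² + (1 - ρ²) k²)`, which is nonnegative and nondecreasing in `x`,
shows that it is nondecreasing as soon as `θ φ` is nondecreasing and `φ` nonincreasing. -/
lemma ssvi_mono_of_antitone {ρ t₁ t₂ f₁ f₂ k : ℝ} (hρ : ρ ^ 2 ≤ 1) (ht₁ : 0 < t₁)
    (hf₁ : 0 < f₁) (hf₂ : 0 < f₂) (hf : f₂ ≤ f₁) (htf : t₁ * f₁ ≤ t₂ * f₂) :
    t₁ / 2 * (1 + ρ * f₁ * k + √((f₁ * k + ρ) ^ 2 + (1 - ρ ^ 2)))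
      ≤ t₂ / 2 * (1 + ρ * f₂ * k + √((f₂ * k + ρ) ^ 2 + (1 - ρ ^ 2))) := by
  set c : ℝ := (1 - ρ ^ 2) * k ^ 2 with hcdef
  have hc : 0 ≤ c := mul_nonneg (by linarith) (sq_nonneg k)
  have hform : ∀ t f : ℝ, 0 < f →
      t / 2 * (1 + ρ * f * k + √((f * k + ρ) ^ 2 + (1 - ρ ^ 2)))
        = t * f / 2 * ((1 / f + ρ * k) + √((1 / f + ρ * k) ^ 2 + c)) := by
    intro t f hf
    have : (f * k + ρ) ^ 2 + (1 - ρ ^ 2) = f ^ 2 * ((1 / f + ρ * k) ^ 2 + c) := by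
      rw [hcdef]
      field_simp
      ring
    rw [this, Real.sqrt_mul (sq_nonneg f), Real.sqrt_sq hf.le]
    field_simp
  have hmono : ∀ p q : ℝ, p ≤ q → p + √(p ^ 2 + c) ≤ q + √(q ^ 2 + c) := by
    intro p q hpq
    have : √(p ^ 2 + c) ≤ √(q ^ 2 + c) + (q - p) := by
      refine Real.sqrt_le_iff.2 ⟨add_nonneg (Real.sqrt_nonneg _) (sub_nonneg.2 hpq), ?_⟩
      have h1 : (√(q ^ 2 + c)) ^ 2 = q ^ 2 + c := Real.sq_sqrt (by positivity)
      have h2 : q ≤ √(q ^ 2 + c) := (le_abs_self q).trans (Real.abs_le_sqrt (by linarith))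
      have h3 : -q ≤ √(q ^ 2 + c) := (neg_le_abs q).trans (Real.abs_le_sqrt (by linarith))
      nlinarith
    linarith
  have hnonneg : ∀ p : ℝ, 0 ≤ p + √(p ^ 2 + c) := fun p => by
    have : -p ≤ √(p ^ 2 + c) := (neg_le_abs p).trans (Real.abs_le_sqrt (by linarith))
    linarith
  rw [hform t₁ f₁ hf₁, hform t₂ f₂ hf₂]
  have h1 : 1 / f₁ + ρ * k ≤ 1 / f₂ + ρ * k :=
    add_le_add_left (one_div_le_one_div_of_le hf₂ hf) _
  exact mul_le_mul (by linarith) (hmono _ _ h1) (hnonneg _)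
    (div_nonneg ((mul_pos ht₁ hf₁).le.trans htf) two_pos.le)

lemma ssvi_pos {ρ : ℝ} {φ θ : ℝ → ℝ} {k T : ℝ} (hρ : ρ ^ 2 < 1) (hθ : 0 < θ T) :
    0 < ssvi ρ φ θ k T := by
  have hin : 0 < (φ (θ T) * k + ρ) ^ 2 + (1 - ρ ^ 2) := by nlinarith [sq_nonneg (φ (θ T) * k + ρ)]
  have := ssvi_factor_pos hρ (Real.sqrt_pos.2 hin) (Real.sq_sqrt hin.le)
  rw [ssvi, mul_assoc ρ]
  positivity

lemma IsATMCurve.monotoneOn {θ : ℝ → ℝ} (hθ : IsATMCurve θ) : MonotoneOn θ (Ioi 0) :=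
  monotoneOn_of_deriv_nonneg (convex_Ioi 0)
    (fun T hT => (hθ.differentiableAt T hT).continuousAt.continuousWithinAt)
    (fun T hT => (hθ.differentiableAt T (interior_subset hT)).differentiableWithinAt)
    fun T hT => hθ.deriv_nonneg T (interior_subset hT)

/-- Sufficient conditions for the absence of static arbitrage: Gatheral and Jacquier's butterfly
conditions at every attained level of `θ`, and monotonicity of `φ` and of `x φ(x)`. -/
lemma freeOfStaticArbitrage_ssvi {ρ : ℝ} {φ θ : ℝ → ℝ} (hρ : ρ ^ 2 < 1) (hθ : IsATMCurve θ)
    (hφ : ∀ x, 0 < x → 0 < φ x) (hanti : AntitoneOn φ (Ioi 0))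
    (hmono : MonotoneOn (fun x => x * φ x) (Ioi 0))
    (hA : ∀ T, 0 < T → θ T * φ (θ T) * (1 + |ρ|) < 4)
    (hB : ∀ T, 0 < T → θ T * φ (θ T) ^ 2 * (1 + |ρ|) ≤ 4) :
    FreeOfStaticArbitrage (ssvi ρ φ θ) := by
  refine ⟨fun K _ T₁ hT₁ T₂ hT₂ hT => ?_, fun T hT => freeOfButterflyArbitrage_ssvi hρ (hθ.pos T hT)
    (hφ _ (hθ.pos T hT)) (hA T hT) (hB T hT)⟩
  have h₁ := hθ.pos T₁ hT₁
  have h₂ := hθ.pos T₂ hT₂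
  have h₁₂ := hθ.monotoneOn hT₁ hT₂ hT
  exact bsCall_mono (ssvi_pos hρ h₁) <| ssvi_mono_of_antitone hρ.le h₁ (hφ _ h₁) (hφ _ h₂)
    (hanti h₁ h₂ h₁₂) (hmono h₁ h₂ h₁₂)

/-! ### The modified power law -/

lemma modPowerLaw_pos {η γ x : ℝ} (hη : 0 < η) (hx : 0 < x) : 0 < modPowerLaw η γ x := by
  unfold modPowerLaw
  positivity

lemma antitoneOn_modPowerLaw {η γ : ℝ} (hη : 0 < η) (hγ : γ ∈ Ioo (0 : ℝ) 1) :
    AntitoneOn (modPowerLaw η γ) (Ioi 0) := by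
  intro x hx y _ hxy
  have hx : 0 < x := hx
  have hy : 0 < y := hx.trans_le hxy
  have h0 := hγ.1.le
  have h1 := sub_nonneg.2 hγ.2.le
  unfold modPowerLaw
  gcongr

lemma mul_modPowerLaw {η γ x : ℝ} (hx : 0 < x) :
    x * modPowerLaw η γ x = η * (x / (1 + x)) ^ (1 - γ) := by
  rw [modPowerLaw, Real.div_rpow hx.le (by positivity)]
  have h : x = x ^ γ * x ^ (1 - γ) := by rw [← Real.rpow_add hx]; simp
  nth_rewrite 1 [h]
  field_simp

lemma monotoneOn_mul_modPowerLaw {η γ : ℝ} (hη : 0 < η) (hγ : γ < 1) :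
    MonotoneOn (fun x => x * modPowerLaw η γ x) (Ioi 0) := by
  intro x hx y hy hxy
  have hx : 0 < x := hx
  have hy : 0 < y := hy
  have h1 := sub_nonneg.2 hγ.le
  have h : x / (1 + x) ≤ y / (1 + y) := by
    rw [div_le_div_iff₀ (by positivity) (by positivity)]
    nlinarith
  simp only [mul_modPowerLaw hx, mul_modPowerLaw hy]
  gcongr

lemma mul_modPowerLaw_lt {η γ x : ℝ} (hη : 0 < η) (hγ : γ < 1) (hx : 0 < x) :
    x * modPowerLaw η γ x < η := by
  rw [mul_modPowerLaw hx]
  refine mul_lt_of_lt_one_right hη (Real.rpow_lt_one (by positivity) ?_ (sub_pos.2 hγ))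
  rw [div_lt_one (by positivity)]
  linarith

lemma mul_modPowerLaw_sq {η γ x : ℝ} (hx : 0 < x) :
    x * modPowerLaw η γ x ^ 2 = η ^ 2 * (x ^ (1 - 2 * γ) / (1 + x) ^ (1 + (1 - 2 * γ))) := by
  have h1 : x = (x ^ γ) ^ 2 * x ^ (1 - 2 * γ) := by
    rw [← Real.rpow_natCast, ← Real.rpow_mul hx.le, ← Real.rpow_add hx]
    simp [mul_comm]
  have h2 : (1 + x) ^ (1 + (1 - 2 * γ)) = ((1 + x) ^ (1 - γ)) ^ 2 := by
    rw [← Real.rpow_natCast, ← Real.rpow_mul (by positivity)]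
    congr 1
    push_cast
    ring
  rw [h2, modPowerLaw]
  nth_rewrite 1 [h1]
  field_simp

lemma mul_modPowerLaw_sq_le {η γ x : ℝ} (hη : 0 < η) (hγ : γ < 1) (hx : 0 < x) :
    x * modPowerLaw η γ x ^ 2 ≤ η ^ 2 / x := by
  have h := (mul_modPowerLaw_lt hη hγ hx).le
  have h0 : 0 ≤ x * modPowerLaw η γ x := (mul_pos hx (modPowerLaw_pos hη hx)).le
  rw [le_div_iff₀ hx]
  calc x * modPowerLaw η γ x ^ 2 * x = (x * modPowerLaw η γ x) ^ 2 := by ring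
    _ ≤ η ^ 2 := by gcongr

/-- Weighted AM-GM for `x / a` and `1`, with weights `a / (1 + a)` and `1 / (1 + a)`: the function
`x ^ a / (1 + x) ^ (1 + a)` is maximal at `x = a`. -/
lemma rpow_div_one_add_rpow_le {a x : ℝ} (ha : 0 < a) (hx : 0 < x) :
    x ^ a / (1 + x) ^ (1 + a) ≤ a ^ a / (1 + a) ^ (1 + a) := by
  have h1a : 0 < 1 + a := by positivity
  have h := Real.geom_mean_le_arith_mean2_weighted (w₁ := a / (1 + a)) (w₂ := 1 / (1 + a))
    (p₁ := x / a) (p₂ := 1) (by positivity) (by positivity) (by positivity) zero_le_one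
    (by field_simp; ring)
  have h2 : a / (1 + a) * (x / a) + 1 / (1 + a) * 1 = (1 + x) / (1 + a) := by
    field_simp
    ring
  rw [Real.one_rpow, mul_one, h2] at h
  have h3 := Real.rpow_le_rpow (by positivity) h h1a.le
  rw [← Real.rpow_mul (by positivity), div_mul_cancel₀ _ h1a.ne', Real.div_rpow hx.le ha.le,
    Real.div_rpow (by positivity) h1a.le, div_le_div_iff₀ (by positivity) (by positivity)] at h3
  rw [div_le_div_iff₀ (by positivity) (by positivity)]
  linarith

lemma freeOfStaticArbitrage_ssvi_modPowerLaw {ρ η γ : ℝ} {θ : ℝ → ℝ} (hρ : ρ ∈ Ioo (-1 : ℝ) 1)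
    (hη : 0 < η) (hγ : γ ∈ Ioo (0 : ℝ) 1) (hA : η * (1 + |ρ|) ≤ 4) (hθ : IsATMCurve θ)
    (hB : ∀ T, 0 < T → θ T * modPowerLaw η γ (θ T) ^ 2 * (1 + |ρ|) ≤ 4) :
    FreeOfStaticArbitrage (ssvi ρ (modPowerLaw η γ) θ) := by
  refine freeOfStaticArbitrage_ssvi (by nlinarith [hρ.1, hρ.2]) hθ (fun x => modPowerLaw_pos hη)
    (antitoneOn_modPowerLaw hη hγ) (monotoneOn_mul_modPowerLaw hη hγ.2) (fun T hT => ?_) hB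
  refine lt_of_lt_of_le ?_ hA
  gcongr
  exact mul_modPowerLaw_lt hη hγ.2 (hθ.pos T hT)

lemma isATMCurve_const_mul_rpow {a p : ℝ} (ha : 0 < a) (hp : 0 ≤ p) :
    IsATMCurve fun T => a * T ^ p := by
  have hd : ∀ T : ℝ, 0 < T → HasDerivAt (fun T => a * T ^ p) (a * (p * T ^ (p - 1))) T :=
    fun T hT => (Real.hasDerivAt_rpow_const (Or.inl hT.ne')).const_mul a
  refine ⟨fun T hT => by positivity, fun T hT => (hd T hT).differentiableAt, fun T hT => ?_⟩
  rw [(hd T hT).deriv]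
  positivity

end SSVI

end

theorem mainTheorem1 (ρ η γ : ℝ) (hρ : ρ ∈ Set.Ioo (-1 : ℝ) 1) (hη : 0 < η) :
    (γ ∈ Set.Ioo (0 : ℝ) (1 / 2) ∪ Set.Ioo (1 / 2 : ℝ) 1 → η * (1 + |ρ|) ≤ 4 →
      ∃ θstar : ℝ, 0 < θstar ∧ ∀ θ : ℝ → ℝ, SSVI.IsATMCurve θ →
        (∀ T : ℝ, 0 < T → θstar ≤ θ T) →
        SSVI.FreeOfStaticArbitrage (SSVI.ssvi ρ (SSVI.modPowerLaw η γ) θ)) ∧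
    (γ ∈ Set.Ioo (0 : ℝ) (1 / 2) → η * (1 + |ρ|) ≤ 4 →
      (1 - 2 * γ) * SSVI.modPowerLaw η γ (1 - 2 * γ) ^ 2 * (1 + |ρ|) ≤ 4 →
      ∀ θ : ℝ → ℝ, SSVI.IsATMCurve θ →
        SSVI.FreeOfStaticArbitrage (SSVI.ssvi ρ (SSVI.modPowerLaw η γ) θ)) ∧
    (γ = 1 / 2 → η ^ 2 * (1 + |ρ|) ≤ 4 →
      (∀ θ : ℝ → ℝ, SSVI.IsATMCurve θ →
        SSVI.FreeOfStaticArbitrage (SSVI.ssvi ρ (SSVI.modPowerLaw η γ) θ)) ∧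
      ∀ a p : ℝ, 0 < a → 0 ≤ p →
        SSVI.FreeOfStaticArbitrage
          (SSVI.ssvi ρ (SSVI.modPowerLaw η γ) (fun T => a * T ^ p))) := by
  refine ⟨fun hγ hA => ?_, fun hγ hA hmax θ hθ => ?_, fun hγ hB => ?_⟩
  · have hγ' : γ ∈ Set.Ioo (0 : ℝ) 1 := by
      rcases hγ with h | h
      · exact ⟨h.1, by linarith [h.2]⟩
      · exact ⟨by linarith [h.1], h.2⟩
    -- Since `x φ(x) ≤ η`, the quantity `x φ(x)² (1 + |ρ|)` is at most `η² (1 + |ρ|) / x`.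
    refine ⟨η ^ 2 * (1 + |ρ|) / 4, by positivity, fun θ hθ hle => ?_⟩
    refine SSVI.freeOfStaticArbitrage_ssvi_modPowerLaw hρ hη hγ' hA hθ fun T hT => ?_
    have h0 := hθ.pos T hT
    calc θ T * SSVI.modPowerLaw η γ (θ T) ^ 2 * (1 + |ρ|)
        ≤ η ^ 2 / θ T * (1 + |ρ|) := by
          gcongr
          exact SSVI.mul_modPowerLaw_sq_le hη hγ'.2 h0
      _ = η ^ 2 * (1 + |ρ|) / θ T := by ring
      _ ≤ 4 := by
          rw [div_le_iff₀ h0]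
          linarith [hle T hT]
  · have ha : 0 < 1 - 2 * γ := by linarith [hγ.2]
    refine SSVI.freeOfStaticArbitrage_ssvi_modPowerLaw hρ hη ⟨hγ.1, by linarith [hγ.2]⟩ hA hθ
      fun T hT => le_trans ?_ hmax
    rw [SSVI.mul_modPowerLaw_sq (hθ.pos T hT), SSVI.mul_modPowerLaw_sq ha]
    gcongr ?_ * _
    exact mul_le_mul_of_nonneg_left (SSVI.rpow_div_one_add_rpow_le ha (hθ.pos T hT)) (sq_nonneg η)
  · have hr : |ρ| < 1 := abs_lt.2 hρ
    -- `(η (1 + |ρ|))² ≤ 4 (1 + |ρ|) < 8`, so the bound on `η (1 + |ρ|)` comes for free.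
    have hA : η * (1 + |ρ|) ≤ 4 := by
      refine abs_le_of_sq_le_sq' ?_ (by norm_num) |>.2
      nlinarith [abs_nonneg ρ]
    have main : ∀ θ : ℝ → ℝ, SSVI.IsATMCurve θ →
        SSVI.FreeOfStaticArbitrage (SSVI.ssvi ρ (SSVI.modPowerLaw η γ) θ) := by
      intro θ hθ
      subst hγ
      refine SSVI.freeOfStaticArbitrage_ssvi_modPowerLaw hρ hη ⟨by norm_num, by norm_num⟩ hA hθ
        fun T hT => le_trans ?_ hB
      have h0 := hθ.pos T hT
      gcongr
      rw [SSVI.mul_modPowerLaw_sq h0]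
      -- At `γ = 1 / 2` the quantity `x φ(x)²` equals `η² / (1 + x)`.
      norm_num
      exact mul_le_of_le_one_right (sq_nonneg η) (inv_le_one_of_one_le₀ (by linarith))
    exact ⟨main, fun a p ha hp => main _ (SSVI.isATMCurve_const_mul_rpow ha hp)⟩
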